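/- A constructive real number (CRN) is an algorithmically given sequence of rational numbers $(x_n)$ together with an algorithm that, given a rational $\epsilon>0$, computes an $M$ with $|x_m-x_n|<\epsilon$ for all $m,n>M$. Two CRNs are equal if they have the same limit. Algorithms on CRNs work on the given programs. Let $I$ be an interval of CRNs (open, closed or half-open, bounded or unbounded, its end points being CRNs), and for $x\in I$ let $B(x,n)=\{y\in I: |y-x|<2^{-n}\}$. A set $A\subseteq I$ is *open* in $I$ if there is a (partial) algorithm $G:A\to\mathbb N$ on the points of $I$, whose domain is $A$ (for $x\in I$, it terminates on $x$ if and only if $x\in A$), such that $B(a,G(a))\subseteq A$ for all $a\in A$. A set is *closed* in $I$ if it is the complement in $I$ of a set that is open in $I$. A set $A\subseteq I$ is *suitable* if together with every point it contains all points of $I$ equal to it. Let $A,B\subseteq I$ be nonempty, disjoint and suitable. $I$ is *softly separated* into $A$ and $B$ if no point of $I$ can fail to belong to $A\cup B$; it is *weakly separated* into $A$ and $B$ if every point of $I$ that does not belong to one of the two sets belongs to the other. **Theorem.** An interval $I$ of CRNs cannot be softly separated into two closed subsets. Consequently, $I$ cannot be weakly separated into two closed subsets. -/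

import Mathlib

open Nat.Partrec (Code)

/-- The rational number with code `n`: the code of the triple `u, v, d` of natural numbers stands
for `(u - v) / (d + 1)`. Every rational number has a code. -/
def ratOfNat (n : ℕ) : ℚ :=
  ((n.unpair.1.unpair.1 : ℚ) - (n.unpair.1.unpair.2 : ℚ)) / ((n.unpair.2 : ℚ) + 1)

/-- A constructive real number: a program that computes (codes of) the members of a sequence of
rational numbers, with a program that turns (a code of) any positive rational `ε` into an `M` such
that `|x_m - x_n| < ε` for all `m, n > M`. -/
structure CRN where
  seqProg : Code
  modProg : Code
  total : ∀ n, (seqProg.eval n).Dom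
  regulated : ∀ e, 0 < ratOfNat e → ∃ M ∈ modProg.eval e, ∀ m n, M < m → M < n →
    |ratOfNat ((seqProg.eval m).get (total m)) - ratOfNat ((seqProg.eval n).get (total n))|
      < ratOfNat e

namespace CRN

/-- The `n`-th member of the sequence of rational numbers given by `x`. -/
def term (x : CRN) (n : ℕ) : ℚ := ratOfNat ((x.seqProg.eval n).get (x.total n))

/-- What an algorithm working on constructive real numbers gets as its input: the two programs. -/
def programs (x : CRN) : Code × Code := (x.seqProg, x.modProg)

theorem exists_ratOfNat_pos_le {ε : ℚ} (h : 0 < ε) : ∃ e, 0 < ratOfNat e ∧ ratOfNat e ≤ ε := by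
  obtain ⟨d, hd⟩ := exists_nat_one_div_lt h
  refine ⟨Nat.pair (Nat.pair 1 0) d, ?_, ?_⟩
  · simp only [ratOfNat, Nat.unpair_pair]
    push_cast
    rw [sub_zero]
    positivity
  · simpa [ratOfNat] using hd.le

theorem isCauSeq_term (x : CRN) : IsCauSeq abs x.term := by
  intro ε hε
  obtain ⟨e, he, hle⟩ := exists_ratOfNat_pos_le hε
  obtain ⟨M, -, hM⟩ := x.regulated e he
  exact ⟨M + 1, fun j hj => (hM j (M + 1) (by omega) (by omega)).trans_le hle⟩

/-- The sequence of `x` as a Cauchy sequence of rational numbers. -/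
def cauSeq (x : CRN) : CauSeq ℚ abs := ⟨x.term, x.isCauSeq_term⟩

/-- The real number to which the sequence of `x` converges. -/
noncomputable def toReal (x : CRN) : ℝ := Real.mk x.cauSeq

/-- Equality of constructive real numbers: members of the two sequences with sufficiently large
indices are as close as desired. -/
def Equal (x y : CRN) : Prop :=
  ∀ ε : ℚ, 0 < ε → ∃ N, ∀ m n, N < m → N < n → |x.term m - y.term n| < ε

/-- The order of the constructive real numbers is that of their values. -/
noncomputable instance : Preorder CRN := Preorder.lift toReal

/-- Intervals whose end points (if any) are constructive real numbers. -/
def IsInterval (I : Set CRN) : Prop :=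
  (∃ a b : CRN, I = Set.Icc a b ∨ I = Set.Ico a b ∨ I = Set.Ioc a b ∨ I = Set.Ioo a b) ∨
  (∃ a : CRN, I = Set.Ici a ∨ I = Set.Ioi a ∨ I = Set.Iic a ∨ I = Set.Iio a) ∨
  I = Set.univ

/-- The open ball `B(x, n)` of radius `2 ^ (-n)` in the space `X`. -/
def ball (X : Set CRN) (x : CRN) (n : ℕ) : Set CRN :=
  {y | y ∈ X ∧ |y.toReal - x.toReal| < (1 / 2 : ℝ) ^ n}

/-- `A` is a suitable subset of `X`: with every point it contains all points of `X` equal to it. -/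
def IsSuitable (X A : Set CRN) : Prop :=
  A ⊆ X ∧ ∀ x ∈ A, ∀ y ∈ X, Equal x y → y ∈ A

/-- `A` is open in `X`: there is an algorithm `G : A → ℕ` with `B(a, G(a)) ⊆ A` for `a ∈ A`.
The algorithm is a partial one on the points of `X`, with domain `A`. It works on programs, and
its results on equal points may differ. -/
def IsOpenIn (X A : Set CRN) : Prop :=
  A ⊆ X ∧ ∃ G : Code × Code →. ℕ, Partrec G ∧
    (∀ x ∈ X, (G x.programs).Dom ↔ x ∈ A) ∧
    ∀ a ∈ A, ∀ n ∈ G a.programs, ball X a n ⊆ A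

/-- `A` is closed in `X`: it is the complement of a set that is open in `X`. -/
def IsClosedIn (X A : Set CRN) : Prop :=
  ∃ U, IsOpenIn X U ∧ A = X \ U

/-- The standing conditions on the two subsets in each kind of separation of `X`. -/
def IsSeparationPair (X A B : Set CRN) : Prop :=
  IsSuitable X A ∧ IsSuitable X B ∧ A.Nonempty ∧ B.Nonempty ∧ A ∩ B = ∅

/-- `X` is softly separated into `A` and `B`: no point of `X` can fail to be in their union. -/
def SoftlySeparated (X A B : Set CRN) : Prop :=
  IsSeparationPair X A B ∧ ∀ x ∈ X, ¬¬(x ∈ A ∪ B)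

/-- `X` is weakly separated into `A` and `B`: a point of `X` that is not in one of the two sets is
in the other one. -/
def WeaklySeparated (X A B : Set CRN) : Prop :=
  IsSeparationPair X A B ∧ ∀ x ∈ X, (x ∉ A → x ∈ B) ∧ (x ∉ B → x ∈ A)

end CRN

/-! Two disjoint closed sets that cover the interval are complements of each other, hence both open,
so it suffices to show that no two nonempty disjoint open sets `A`, `B` cover it. Each then contains
a rational point. Membership in `A` and in `B` is semidecidable, so running both algorithms in
parallel decides the side of every rational in the interval (`exists_partrec_decide`). Bisection
from a rational in `A` to one in `B` is therefore computable (`computable_bisect`), and its limit is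
a constructive real in the interval. A ball around the limit lies in one of the sets, yet contains
late end points of both kinds.

Computability is essential: the values of the constructive reals form a countable set, which is not
connected classically. -/

/-- A code of the midpoint of the rational numbers with codes `a` and `b`. -/
def midCode (a b : ℕ) : ℕ :=
  Nat.pair
    (Nat.pair
      (a.unpair.1.unpair.1 * (b.unpair.2 + 1) + b.unpair.1.unpair.1 * (a.unpair.2 + 1))
      (a.unpair.1.unpair.2 * (b.unpair.2 + 1) + b.unpair.1.unpair.2 * (a.unpair.2 + 1)))
    -- `ratOfNat` adds 1 to the stored denominator.
    (2 * ((a.unpair.2 + 1) * (b.unpair.2 + 1)) - 1)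

theorem ratOfNat_midCode (a b : ℕ) :
    ratOfNat (midCode a b) = (ratOfNat a + ratOfNat b) / 2 := by
  have h : 1 ≤ 2 * ((a.unpair.2 + 1) * (b.unpair.2 + 1)) := by
    have : 0 < (a.unpair.2 + 1) * (b.unpair.2 + 1) := by positivity
    omega
  have ha : (a.unpair.2 : ℚ) + 1 ≠ 0 := by positivity
  have hb : (b.unpair.2 : ℚ) + 1 ≠ 0 := by positivity
  simp only [ratOfNat, midCode, Nat.unpair_pair, Nat.cast_sub h]
  push_cast
  rw [sub_add_cancel]
  field_simp
  ring

theorem Primrec.comp_mul_comp {f g : ℕ → ℕ} (hf : Primrec f) (hg : Primrec g) :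
    Primrec fun p : ℕ × ℕ => f p.1 * g p.2 :=
  Primrec.nat_mul.comp (hf.comp Primrec.fst) (hg.comp Primrec.snd)

theorem Primrec.cross_add {f g : ℕ → ℕ} (hf : Primrec f) (hg : Primrec g) :
    Primrec fun p : ℕ × ℕ => f p.1 * g p.2 + f p.2 * g p.1 :=
  Primrec.nat_add.comp (Primrec.comp_mul_comp hf hg)
    ((Primrec.comp_mul_comp hf hg).comp (Primrec.pair Primrec.snd Primrec.fst))

theorem primrec_midCode : Primrec₂ midCode := by
  have fst : Primrec fun n : ℕ => n.unpair.1 := Primrec.fst.comp Primrec.unpair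
  have snd : Primrec fun n : ℕ => n.unpair.2 := Primrec.snd.comp Primrec.unpair
  have d : Primrec fun n : ℕ => n.unpair.2 + 1 := Primrec.succ.comp snd
  have num := Primrec₂.natPair.comp (Primrec.cross_add (fst.comp fst) d)
    (Primrec.cross_add (snd.comp fst) d)
  have den := Primrec.nat_sub.comp
    (Primrec.nat_mul.comp (Primrec.const 2) (Primrec.comp_mul_comp d d)) (Primrec.const 1)
  exact (Primrec₂.natPair.comp num den).of_eq fun p => by simp only [midCode]

attribute [irreducible] midCode

theorem ratOfNat_surjective : Function.Surjective ratOfNat := by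
  intro q
  refine ⟨Nat.pair (Nat.pair q.num.toNat (-q.num).toNat) (q.den - 1), ?_⟩
  have h1 : ((q.num.toNat : ℚ) - ((-q.num).toNat : ℚ)) = q.num := by
    have : ((q.num.toNat : ℤ) - ((-q.num).toNat : ℤ)) = q.num := by omega
    exact_mod_cast this
  simp only [ratOfNat, Nat.unpair_pair, h1, Nat.cast_sub q.den_pos]
  simp [Rat.num_div_den]

/-- A positive numerator is an integer, so at least 1. Thus the denominator alone yields a modulus
of convergence. -/
theorem one_div_le_ratOfNat {e : ℕ} (he : 0 < ratOfNat e) :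
    1 / ((e.unpair.2 : ℚ) + 1) ≤ ratOfNat e := by
  have hd : (0 : ℚ) < (e.unpair.2 : ℚ) + 1 := by positivity
  have h := (div_pos_iff_of_pos_right hd).1 he
  unfold ratOfNat
  gcongr
  have h' : e.unpair.1.unpair.2 < e.unpair.1.unpair.1 := by
    have := sub_pos.1 h
    exact_mod_cast this
  have : ((e.unpair.1.unpair.2 + 1 : ℕ) : ℚ) ≤ (e.unpair.1.unpair.1 : ℕ) := by exact_mod_cast h'
  push_cast at this
  linarith

/-! ### Constructive reals from computable sequences -/

namespace CRN

/-- The constant sequence with value the rational number with code `c`. -/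
def ofCode (c : ℕ) : CRN where
  seqProg := Code.const c
  modProg := Code.zero
  total n := by simp [Code.eval_const]
  regulated e he := by
    refine ⟨0, Part.mem_some 0, fun m n _ _ => ?_⟩
    simpa [Code.eval_const] using he

theorem term_ofCode (c n : ℕ) : (ofCode c).term n = ratOfNat c := by
  simp [term, ofCode, Code.eval_const]

theorem toReal_ofCode (c : ℕ) : (ofCode c).toReal = ratOfNat c := by
  have h : |(ofCode c).toReal - ratOfNat c| ≤ 0 :=
    Real.mk_near_of_forall_near ⟨0, fun j _ => by
      change |(((ofCode c).term j : ℚ) : ℝ) - _| ≤ 0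
      simp [term_ofCode]⟩
  exact sub_eq_zero.1 (abs_nonpos_iff.1 h)

theorem computable_programs_ofCode : Computable fun c => (ofCode c).programs :=
  (Code.primrec_const.pair (Primrec.const Code.zero)).to_comp

/-- A computable sequence of codes of rational numbers that converges at a geometric rate defines
a constructive real number. -/
theorem exists_term_eq {f : ℕ → ℕ} (hf : Computable f) (K : ℕ)
    (h : ∀ k m n, k ≤ m → k ≤ n → |ratOfNat (f m) - ratOfNat (f n)| ≤ K / 2 ^ k) :
    ∃ z : CRN, ∀ n, z.term n = ratOfNat (f n) := by
  obtain ⟨s, hs⟩ := Code.exists_code.1 (Partrec.nat_iff.1 hf)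
  -- With `M = K * (d + 1)`, the inequality `M < 2 ^ M` gives `K / 2 ^ M < 1 / (d + 1)`.
  have hg : Computable fun e : ℕ => K * (e.unpair.2 + 1) :=
    (Primrec.nat_mul.comp (Primrec.const K)
      (Primrec.succ.comp (Primrec.snd.comp Primrec.unpair))).to_comp
  obtain ⟨g, hg⟩ := Code.exists_code.1 (Partrec.nat_iff.1 hg)
  have hs' : ∀ n, s.eval n = Part.some (f n) := fun n => by rw [hs]; rfl
  refine ⟨⟨s, g, fun n => by simp [hs'], fun e he => ⟨K * (e.unpair.2 + 1), ?_, ?_⟩⟩, ?_⟩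
  · rw [hg]; exact Part.mem_some _
  · intro m n hm hn
    simp only [hs', Part.get_some]
    refine ((h _ m n hm.le hn.le).trans_lt ?_).trans_le (one_div_le_ratOfNat he)
    rw [div_lt_div_iff₀ (by positivity) (by positivity), one_mul]
    exact_mod_cast Nat.lt_two_pow_self
  · intro n
    simp [term, hs']

theorem IsInterval.ordConnected {I : Set CRN} (hI : IsInterval I) : I.OrdConnected := by
  rcases hI with ⟨a, b, rfl | rfl | rfl | rfl⟩ | ⟨a, rfl | rfl | rfl | rfl⟩ | rfl <;> infer_instance

/-! ### Deciding membership at rational points -/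

theorem IsOpenIn.exists_ball_subset {X A : Set CRN} (hA : IsOpenIn X A) {a : CRN} (ha : a ∈ A) :
    ∃ n, ball X a n ⊆ A := by
  obtain ⟨hAX, G, -, hdom, hball⟩ := hA
  have h := (hdom a (hAX ha)).2 ha
  exact ⟨_, hball a ha _ (Part.get_mem h)⟩

/-- If the interval is the disjoint union of two open sets, then an algorithm decides to which of
them a rational number in the interval belongs. -/
theorem exists_partrec_decide {X A B : Set CRN} (hA : IsOpenIn X A) (hB : IsOpenIn X B)
    (hAB : A ∩ B = ∅) (hX : X ⊆ A ∪ B) :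
    ∃ k : ℕ →. Bool, Partrec k ∧ ∀ c, ofCode c ∈ X → ∃ t ∈ k c, (t = true ↔ ofCode c ∈ A) := by
  obtain ⟨-, G, hG, hGdom, -⟩ := hA
  obtain ⟨-, H, hH, hHdom, -⟩ := hB
  have hp := computable_programs_ofCode
  have hG' : Partrec fun c => (G (ofCode c).programs).map fun _ => true :=
    (hG.comp hp).map (Computable.const true).to₂
  have hH' : Partrec fun c => (H (ofCode c).programs).map fun _ => false :=
    (hH.comp hp).map (Computable.const false).to₂
  -- The two searches run in parallel: `k` halts when either does, with an answer given by one of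
  -- them.
  obtain ⟨k, hk, hkGH⟩ := Partrec.merge' hG' hH'
  refine ⟨k, hk, fun c hc => ?_⟩
  have hdom : (k c).Dom := by
    rw [(hkGH c).2]
    exact (hX hc).imp (hGdom _ hc).2 (hHdom _ hc).2
  refine ⟨_, Part.get_mem hdom, ?_⟩
  rcases (hkGH c).1 _ (Part.get_mem hdom) with h | h
  · obtain ⟨y, hy, ht⟩ := (Part.mem_map_iff _).1 h
    rw [← ht]
    exact iff_of_true rfl ((hGdom _ hc).1 (Part.dom_iff_mem.2 ⟨y, hy⟩))
  · obtain ⟨y, hy, ht⟩ := (Part.mem_map_iff _).1 h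
    rw [← ht]
    refine iff_of_false (by simp) fun hcA => ?_
    exact Set.eq_empty_iff_forall_notMem.1 hAB _
      ⟨hcA, (hHdom _ hc).1 (Part.dom_iff_mem.2 ⟨y, hy⟩)⟩

/-! ### Bisection -/

open Classical in
/-- Bisection of the segment between the rational numbers with codes `p.1` and `p.2`, keeping the
first end point in `A` and the second one out of `A`. -/
noncomputable def bisect (A : Set CRN) (p : ℕ × ℕ) : ℕ → ℕ × ℕ
  | 0 => p
  | n + 1 =>
    let q := bisect A p n
    if ofCode (midCode q.1 q.2) ∈ A then (midCode q.1 q.2, q.2) else (q.1, midCode q.1 q.2)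

/-- The rational numbers with codes in `p` are in the segment between those with codes in `q`. -/
def SegmentLE (p q : ℕ × ℕ) : Prop :=
  ratOfNat p.1 ∈ Set.uIcc (ratOfNat q.1) (ratOfNat q.2) ∧
    ratOfNat p.2 ∈ Set.uIcc (ratOfNat q.1) (ratOfNat q.2)

theorem SegmentLE.trans {p q r : ℕ × ℕ} (h : SegmentLE p q) (h' : SegmentLE q r) :
    SegmentLE p r :=
  have hs := Set.uIcc_subset_uIcc h'.1 h'.2
  ⟨hs h.1, hs h.2⟩

theorem ratOfNat_midCode_mem (a b : ℕ) :
    ratOfNat (midCode a b) ∈ Set.uIcc (ratOfNat a) (ratOfNat b) := by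
  rw [ratOfNat_midCode, Set.mem_uIcc]
  rcases le_total (ratOfNat a) (ratOfNat b) with h | h
  · left; constructor <;> linarith
  · right; constructor <;> linarith

theorem bisect_succ_segmentLE (A : Set CRN) (p : ℕ × ℕ) (n : ℕ) :
    SegmentLE (bisect A p (n + 1)) (bisect A p n) := by
  have hm := ratOfNat_midCode_mem (bisect A p n).1 (bisect A p n).2
  simp only [bisect]
  split_ifs
  · exact ⟨hm, Set.right_mem_uIcc⟩
  · exact ⟨Set.left_mem_uIcc, hm⟩

theorem bisect_segmentLE (A : Set CRN) (p : ℕ × ℕ) {m n : ℕ} (h : m ≤ n) :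
    SegmentLE (bisect A p n) (bisect A p m) := by
  induction n, h using Nat.le_induction with
  | base => exact ⟨Set.left_mem_uIcc, Set.right_mem_uIcc⟩
  | succ n _ ih => exact (bisect_succ_segmentLE A p n).trans ih

theorem bisect_length (A : Set CRN) (p : ℕ × ℕ) (n : ℕ) :
    |ratOfNat (bisect A p n).2 - ratOfNat (bisect A p n).1|
      = |ratOfNat p.2 - ratOfNat p.1| / 2 ^ n := by
  induction n with
  | zero => simp [bisect]
  | succ n ih =>
    have half (x : ℚ) : |x| / 2 = |x / 2| := by rw [abs_div, abs_two]
    rw [pow_succ, ← div_div, ← ih, half]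
    simp only [bisect]
    split_ifs
    · rw [ratOfNat_midCode]; congr 1; ring
    · rw [ratOfNat_midCode]; congr 1; ring

theorem bisect_fst_mem {A : Set CRN} {p : ℕ × ℕ} (hp : ofCode p.1 ∈ A) (n : ℕ) :
    ofCode (bisect A p n).1 ∈ A := by
  induction n with
  | zero => exact hp
  | succ n ih =>
    simp only [bisect]
    split_ifs with h
    · exact h
    · exact ih

theorem bisect_snd_notMem {A : Set CRN} {p : ℕ × ℕ} (hp : ofCode p.2 ∉ A) (n : ℕ) :
    ofCode (bisect A p n).2 ∉ A := by
  induction n with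
  | zero => exact hp
  | succ n ih =>
    simp only [bisect]
    split_ifs with h
    · exact ih
    · exact h

/-- All midpoints stay in the initial segment, where `k` halts and agrees with the classical case
distinction in `bisect`. -/
theorem computable_bisect {A : Set CRN} {p : ℕ × ℕ} {k : ℕ →. Bool} (hk : Partrec k)
    (h : ∀ c, ratOfNat c ∈ Set.uIcc (ratOfNat p.1) (ratOfNat p.2) →
      ∃ t ∈ k c, (t = true ↔ ofCode c ∈ A)) :
    Computable (bisect A p) := by
  let step (q : ℕ × ℕ) : Part (ℕ × ℕ) := (k (midCode q.1 q.2)).map fun t =>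
    bif t then (midCode q.1 q.2, q.2) else (q.1, midCode q.1 q.2)
  have hmid : Computable fun q : ℕ × ℕ => midCode q.1 q.2 := Primrec.to_comp primrec_midCode
  have hstep : Partrec step := by
    refine (hk.comp hmid).map ?_
    exact Computable.cond Computable.snd
      ((hmid.comp Computable.fst).pair (Computable.snd.comp Computable.fst))
      ((Computable.fst.comp Computable.fst).pair (hmid.comp Computable.fst))
  have hrec : Partrec fun n : ℕ =>
      (n.rec (Part.some p) fun _ IH => IH.bind fun q => step q : Part (ℕ × ℕ)) :=
    Partrec.nat_rec Computable.id (Computable.const p)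
      (hstep.comp (Computable.snd.comp Computable.snd)).to₂
  refine hrec.of_eq fun n => ?_
  induction n with
  | zero => rfl
  | succ n ih =>
    simp only [PFun.coe_val] at ih ⊢
    rw [ih, Part.bind_some]
    have hseg := bisect_segmentLE A p (Nat.zero_le n)
    obtain ⟨t, ht, htA⟩ := h (midCode (bisect A p n).1 (bisect A p n).2)
      (Set.uIcc_subset_uIcc hseg.1 hseg.2 (ratOfNat_midCode_mem _ _))
    simp only [step, bisect, Part.eq_some_iff.2 ht, Part.map_some, ← htA]
    cases t <;> rfl

/-! ### Connectedness -/

/-- If two points of an order connected set `X` are rational, one in `A` and one in `B`, then `X`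
is not the disjoint union of the open sets `A` and `B`. -/
theorem not_subset_union_of_ofCode_mem {X A B : Set CRN} (hX : X.OrdConnected)
    (hA : IsOpenIn X A) (hB : IsOpenIn X B) (hAB : A ∩ B = ∅) {a b : ℕ}
    (ha : ofCode a ∈ A) (hb : ofCode b ∈ B) : ¬ X ⊆ A ∪ B := by
  intro hXAB
  have hdisj : ∀ x, x ∈ A → x ∉ B := fun x hx hx' =>
    Set.eq_empty_iff_forall_notMem.1 hAB x ⟨hx, hx'⟩
  have hseg : ∀ x : CRN, x.toReal ∈ Set.uIcc (ratOfNat a : ℝ) (ratOfNat b) → x ∈ X := by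
    intro x hx
    rw [← toReal_ofCode, ← toReal_ofCode, Set.mem_uIcc] at hx
    rcases hx with hx | hx
    · exact hX.out (hA.1 ha) (hB.1 hb) hx
    · exact hX.out (hB.1 hb) (hA.1 ha) hx
  have hcast : ∀ q : ℚ, q ∈ Set.uIcc (ratOfNat a) (ratOfNat b) →
      (q : ℝ) ∈ Set.uIcc (ratOfNat a : ℝ) (ratOfNat b) := by
    intro q hq
    rw [Set.mem_uIcc] at hq ⊢
    exact_mod_cast hq
  have hcode : ∀ c, ratOfNat c ∈ Set.uIcc (ratOfNat a) (ratOfNat b) → ofCode c ∈ X :=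
    fun c hc => hseg _ (by rw [toReal_ofCode]; exact hcast _ hc)
  obtain ⟨k, hk, hkA⟩ := exists_partrec_decide hA hB hAB hXAB
  set s := bisect A (a, b)
  have hcomp : Computable s := computable_bisect hk fun c hc => hkA c (hcode c hc)
  obtain ⟨K, hK⟩ := exists_nat_ge |ratOfNat b - ratOfNat a|
  have hnear : ∀ i m, i ≤ m → ∀ q ∈ Set.uIcc (ratOfNat (s i).1) (ratOfNat (s i).2),
      |ratOfNat (s m).1 - q| ≤ K / 2 ^ i := by
    intro i m him q hq
    calc |ratOfNat (s m).1 - q| ≤ |ratOfNat (s i).2 - ratOfNat (s i).1| :=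
          Set.abs_sub_le_of_uIcc_subset_uIcc
            (Set.uIcc_subset_uIcc hq (bisect_segmentLE A (a, b) him).1)
      _ = |ratOfNat b - ratOfNat a| / 2 ^ i := bisect_length A (a, b) i
      _ ≤ K / 2 ^ i := by gcongr
  obtain ⟨z, hz⟩ := exists_term_eq (Computable.fst.comp hcomp) K fun i m n hm hn =>
    hnear i m hm _ (bisect_segmentLE A (a, b) hn).1
  have hzX : z ∈ X := by
    apply hseg
    have hmem : ∀ j, (z.term j : ℝ) ∈ Set.uIcc (ratOfNat a : ℝ) (ratOfNat b) := fun j => by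
      rw [hz]
      exact hcast _ (bisect_segmentLE A (a, b) (Nat.zero_le j)).1
    exact ⟨Real.le_mk_of_forall_le ⟨0, fun j _ => (hmem j).1⟩,
      Real.mk_le_of_forall_le ⟨0, fun j _ => (hmem j).2⟩⟩
  have hzs : ∀ i, ∀ q ∈ Set.uIcc (ratOfNat (s i).1) (ratOfNat (s i).2),
      |z.toReal - q| ≤ K / 2 ^ i := by
    intro i q hq
    refine Real.mk_near_of_forall_near ⟨i, fun j hj => ?_⟩
    change |((z.term j : ℚ) : ℝ) - q| ≤ _
    rw [hz]
    have h : ((|ratOfNat (s j).1 - q| : ℚ) : ℝ) ≤ ((K / 2 ^ i : ℚ) : ℝ) :=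
      Rat.cast_le.2 (hnear i j hj q hq)
    simpa only [Rat.cast_abs, Rat.cast_sub, Rat.cast_div, Rat.cast_natCast, Rat.cast_pow,
      Rat.cast_ofNat] using h
  have hball : ∀ n, ∃ i, ∀ c, ratOfNat c ∈ Set.uIcc (ratOfNat (s i).1) (ratOfNat (s i).2) →
      ofCode c ∈ ball X z n := by
    intro n
    -- Stage `K + n` suffices because `K < 2 ^ K`.
    refine ⟨K + n, fun c hc => ⟨hcode c ?_, ?_⟩⟩
    · have h := bisect_segmentLE A (a, b) (Nat.zero_le (K + n))
      exact Set.uIcc_subset_uIcc h.1 h.2 hc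
    · rw [toReal_ofCode, abs_sub_comm]
      refine (hzs _ _ hc).trans_lt ?_
      have hK2 : (K : ℝ) < 2 ^ K := by exact_mod_cast Nat.lt_two_pow_self
      rw [one_div, inv_pow, ← one_div, div_lt_div_iff₀ (by positivity) (by positivity), pow_add,
        one_mul]
      gcongr
  rcases hXAB hzX with h | h
  · obtain ⟨n, hn⟩ := hA.exists_ball_subset h
    obtain ⟨i, hi⟩ := hball n
    exact bisect_snd_notMem (A := A) (p := (a, b)) (fun h' => hdisj _ h' hb) i
      (hn (hi _ Set.right_mem_uIcc))
  · obtain ⟨n, hn⟩ := hB.exists_ball_subset h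
    obtain ⟨i, hi⟩ := hball n
    exact hdisj _ (bisect_fst_mem (p := (a, b)) ha i) (hn (hi _ Set.left_mem_uIcc))

/-- Rationals close to `a` on the side of `b` lie in `X` by order connectedness, hence in the ball
that `A` contains. -/
theorem IsOpenIn.exists_ofCode_mem {X A : Set CRN} (hX : X.OrdConnected) (hA : IsOpenIn X A)
    {a b : CRN} (ha : a ∈ A) (hb : b ∈ X) (hab : a.toReal ≠ b.toReal) :
    ∃ c, ofCode c ∈ A := by
  obtain ⟨n, hn⟩ := hA.exists_ball_subset ha
  have hr : (0 : ℝ) < (1 / 2) ^ n := by positivity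
  rcases hab.lt_or_gt with h | h
  · obtain ⟨q, hq, hq'⟩ := exists_rat_btwn (lt_min h (lt_add_of_pos_right a.toReal hr))
    obtain ⟨c, rfl⟩ := ratOfNat_surjective q
    rw [lt_min_iff] at hq'
    rw [← toReal_ofCode] at hq hq'
    refine ⟨c, hn ⟨hX.out (hA.1 ha) hb ⟨hq.le, hq'.1.le⟩, ?_⟩⟩
    rw [abs_lt]
    constructor <;> linarith [hq'.2]
  · obtain ⟨q, hq', hq⟩ := exists_rat_btwn (max_lt h (sub_lt_self a.toReal hr))
    obtain ⟨c, rfl⟩ := ratOfNat_surjective q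
    rw [max_lt_iff] at hq'
    rw [← toReal_ofCode] at hq hq'
    refine ⟨c, hn ⟨hX.out hb (hA.1 ha) ⟨hq'.1.le, hq.le⟩, ?_⟩⟩
    rw [abs_lt]
    constructor <;> linarith [hq'.2]

/-- An order connected set of constructive real numbers is not the union of two nonempty disjoint
open subsets. -/
theorem not_subset_union_of_isOpenIn {X A B : Set CRN} (hX : X.OrdConnected)
    (hA : IsOpenIn X A) (hB : IsOpenIn X B) (hAB : A ∩ B = ∅) (hA' : A.Nonempty)
    (hB' : B.Nonempty) : ¬ X ⊆ A ∪ B := by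
  obtain ⟨a, ha⟩ := hA'
  obtain ⟨b, hb⟩ := hB'
  -- A point with the value of `a` lies in every ball around `a`.
  have hab : a.toReal ≠ b.toReal := by
    intro h
    obtain ⟨n, hn⟩ := hA.exists_ball_subset ha
    exact Set.eq_empty_iff_forall_notMem.1 hAB b ⟨hn ⟨hB.1 hb, by simp [h]⟩, hb⟩
  obtain ⟨c, hc⟩ := hA.exists_ofCode_mem hX ha (hB.1 hb) hab
  obtain ⟨d, hd⟩ := hB.exists_ofCode_mem hX hb (hA.1 ha) hab.symm
  exact not_subset_union_of_ofCode_mem hX hA hB hAB hc hd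

/-- Classically the double negation drops, so each closed set equals the open complement of the
other. -/
theorem not_softlySeparated {X V W : Set CRN} (hX : X.OrdConnected) (hV : IsClosedIn X V)
    (hW : IsClosedIn X W) : ¬ SoftlySeparated X V W := by
  rintro ⟨⟨-, -, hV', hW', hVW⟩, hcover⟩
  have hcover' : X ⊆ V ∪ W := fun x hx => not_not.1 (hcover x hx)
  obtain ⟨U, hU, rfl⟩ := hV
  obtain ⟨T, hT, rfl⟩ := hW
  have hdisj := Set.eq_empty_iff_forall_notMem.1 hVW
  have hUW : X \ T = U := by
    ext x
    refine ⟨fun hx => ?_, fun hx => ?_⟩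
    · by_contra hxU
      exact hdisj x ⟨⟨hx.1, hxU⟩, hx⟩
    · exact (hcover' (hU.1 hx)).resolve_left fun h => h.2 hx
  have hTV : X \ U = T := by
    ext x
    refine ⟨fun hx => ?_, fun hx => ?_⟩
    · by_contra hxT
      exact hdisj x ⟨hx, ⟨hx.1, hxT⟩⟩
    · exact (hcover' (hT.1 hx)).resolve_right fun h => h.2 hx
  rw [hUW] at hVW hW' hcover'
  rw [hTV] at hVW hV' hcover'
  exact not_subset_union_of_isOpenIn hX hT hU hVW hV' hW' hcover'

theorem WeaklySeparated.softlySeparated {X V W : Set CRN} (h : WeaklySeparated X V W) :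
    SoftlySeparated X V W :=
  ⟨h.1, fun x hx hn => hn (Or.inr ((h.2 x hx).1 fun hV => hn (Or.inl hV)))⟩

end CRN

theorem theorem4 (I : Set CRN) (hI : CRN.IsInterval I) :
    (¬ ∃ V W : Set CRN, CRN.IsClosedIn I V ∧ CRN.IsClosedIn I W ∧ CRN.SoftlySeparated I V W) ∧
    (¬ ∃ V W : Set CRN, CRN.IsClosedIn I V ∧ CRN.IsClosedIn I W ∧ CRN.WeaklySeparated I V W) := by
  refine ⟨?_, ?_⟩
  · rintro ⟨V, W, hV, hW, h⟩
    exact CRN.not_softlySeparated hI.ordConnected hV hW h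
  · rintro ⟨V, W, hV, hW, h⟩
    exact CRN.not_softlySeparated hI.ordConnected hV hW h.softlySeparated
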